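/- Let $\mathbb{K}$ be an algebraically closed field of characteristic $0$, let $p\in\mathbb{K}[x,y]\setminus(\mathbb{K}[x]\cup\mathbb{K}[y])$ be irreducible, and let $r\in\mathbb{K}(x,y)$. Write $\mathbb{K}[x,y]_p$ for the ring of rational functions whose reduced denominator is not divisible by $p$, $\langle p\rangle$ for the ideal of $\mathbb{K}[x,y]_p$ generated by $p$, and $$\mathrm{F}(r,p)=\{(f,g)\in\mathbb{K}(x)\times\mathbb{K}(y) : f-g\in r+\langle p\rangle\}.$$ Let $C\subset\mathbb{P}^1(\mathbb{K})\times\mathbb{P}^1(\mathbb{K})$ be the zero set of the bi-homogenization $x_0^{\deg_x p}\,y_0^{\deg_y p}\,p(x_1/x_0,y_1/y_0)$ of $p$. Poles. The point $(\infty,\infty)$ is a pole of $r$ on the curve associated with $p$ if there is a Puiseux series $\varphi$ over $\mathbb{K}$ in $x^{-1}$ such that $p(x,\varphi)=0$, $\deg\varphi>0$, and $r(x,\varphi)$ is defined with $\deg r(x,\varphi)>0$, where $\deg$ is the largest exponent of $x$. A point $(s_1,s_2)\in C$ is a pole of $r$ if there are fractional linear transformations $T_1,T_2$ of $\mathbb{P}^1(\mathbb{K})$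 such that $T=(T_1,T_2)$ maps $(s_1,s_2)$ to $(\infty,\infty)$ and $(\infty,\infty)$ is a pole of $r\circ T^{-1}$ on the curve associated with the numerator of $p\circ T^{-1}$. Paths. The orbit of a point of $C$ is its class under the smallest equivalence relation on $C$ that relates any two points sharing their first or their second coordinate. The graph of the orbit has the points of the orbit as vertices, two different ones being adjacent if they share a coordinate. An infinite path is a sequence $v_0,v_1,\dots$ of vertices any two consecutive ones of which are adjacent; it is cycle-free if $v_i\neq v_j$ for all $i<j$. Assume that $(s_1,s_2)\in C$ is a pole of $r$, and that $v_0,v_1,\dots$ and $\tilde v_0,\tilde v_1,\dots$ are infinite cycle-free paths in the graph of its orbit that start at $(s_1,s_2)$ and do not contain any other pole of $r$. If the first coordinate of $v_1$ equals $s_1$ and the second coordinate of $\tilde v_1$ equals $s_2$, then $\mathrm{F}(r,p)=\emptyset$. -/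

import Mathlib

noncomputable section

namespace SepVar

universe u

/-- The polynomial ring `K[x, y]`; the variable `x` is `X 0` and `y` is `X 1`. -/
abbrev Poly (K : Type u) [Field K] : Type u := MvPolynomial (Fin 2) K

/-- The field `K(x, y)`. -/
abbrev Rat2 (K : Type u) [Field K] : Type u := FractionRing (Poly K)

variable {K : Type u} [Field K]

/-- `x` as an element of `K(x, y)`. -/
def xvar (K : Type u) [Field K] : Rat2 K := algebraMap (Poly K) (Rat2 K) (MvPolynomial.X 0)

/-- `y` as an element of `K(x, y)`. -/
def yvar (K : Type u) [Field K] : Rat2 K := algebraMap (Poly K) (Rat2 K) (MvPolynomial.X 1)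

/-- The subfield `K(x)` of `K(x, y)`. -/
abbrev Kx (K : Type u) [Field K] : IntermediateField K (Rat2 K) :=
  IntermediateField.adjoin K {xvar K}

/-- The subfield `K(y)` of `K(x, y)`. -/
abbrev Ky (K : Type u) [Field K] : IntermediateField K (Rat2 K) :=
  IntermediateField.adjoin K {yvar K}

/-- The numerator of `r` in reduced form. -/
def numer (r : Rat2 K) : Poly K := IsFractionRing.num (Poly K) r

/-- The denominator of `r` in reduced form. -/
def denom (r : Rat2 K) : Poly K := (IsFractionRing.den (Poly K) r : Poly K)

/-- The (underlying set of the) local ring `K[x, y]_p`: the rational functions whose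
denominator is not divisible by `p`. -/
def localRing (p : Poly K) : Set (Rat2 K) := {q | ¬ p ∣ denom q}

/-- The (underlying set of the) ideal `⟨p⟩` that `p` generates in `K[x, y]_p`. -/
def idealOf (p : Poly K) : Set (Rat2 K) :=
  {h | ∃ q ∈ localRing p, h = q * algebraMap (Poly K) (Rat2 K) p}

/-- `F(r, p)`: the pairs `(f, g)` in `K(x) × K(y)` with `f - g ∈ r + ⟨p⟩`. -/
def F (r : Rat2 K) (p : Poly K) : Set (Kx K × Ky K) :=
  {fg | ∃ h ∈ idealOf p, (fg.1 : Rat2 K) - (fg.2 : Rat2 K) = r + h}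

/-! ### The curve in `ℙ¹ × ℙ¹`; `ℙ¹(K)` is `OnePoint K`, that is `K ∪ {∞}` -/

/-- The bi-homogenization of `p`: the variables `X (0, 0), X (0, 1)` are `x₀, x₁`, the
variables `X (1, 0), X (1, 1)` are `y₀, y₁`, and `x = x₁ / x₀`, `y = y₁ / y₀`. -/
def biHomogenization (p : Poly K) : MvPolynomial (Fin 2 × Fin 2) K :=
  ∑ m ∈ p.support, MvPolynomial.C (p.coeff m)
    * (MvPolynomial.X (0, 0) ^ (p.degreeOf 0 - m 0) * MvPolynomial.X (0, 1) ^ m 0)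
    * (MvPolynomial.X (1, 0) ^ (p.degreeOf 1 - m 1) * MvPolynomial.X (1, 1) ^ m 1)

/-- Homogeneous coordinates: `(1 : a)` for `a` in `K`, and `(0 : 1)` for `∞`. -/
def homCoords : OnePoint K → Fin 2 → K
  | none => ![0, 1]
  | some a => ![1, a]

/-- The curve in `ℙ¹ × ℙ¹` associated with `p`, the zero set of the bi-homogenization. -/
def curve (p : Poly K) : Set (OnePoint K × OnePoint K) :=
  {s | MvPolynomial.eval
    (fun i : Fin 2 × Fin 2 => if i.1 = 0 then homCoords s.1 i.2 else homCoords s.2 i.2)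
    (biHomogenization p) = 0}

/-! ### Puiseux series in `x⁻¹` -/

/-- A Hahn series `∑ c_q t ^ q`, `q` rational, is a Puiseux series if its exponents have a common
denominator. Here the variable `t` plays the role of `x⁻¹`. -/
def IsPuiseux (φ : HahnSeries ℚ K) : Prop :=
  ∃ n : ℕ, 0 < n ∧ ∀ q ∈ φ.support, ∃ m : ℤ, q = (m : ℚ) / (n : ℚ)

/-- The degree in `x` of a series in `x⁻¹`, with `deg 0 = -∞`. -/
def deg (φ : HahnSeries ℚ K) : WithBot ℚ :=
  open Classical in if φ = 0 then ⊥ else ((-φ.order : ℚ) : WithBot ℚ)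

/-- `x` as a series in `x⁻¹`. -/
def xSeries (K : Type u) [Field K] : HahnSeries ℚ K := HahnSeries.single (-1 : ℚ) (1 : K)

/-- `r(u, v)`, for `u, v` in an extension field of `K` where the denominator of `r` does not
vanish. (Where it vanishes the value is `0`.) -/
def evalAt {L : Type*} [Field L] [Algebra K L] (u v : L) (r : Rat2 K) : L :=
  MvPolynomial.aeval ![u, v] (numer r) / MvPolynomial.aeval ![u, v] (denom r)

/-! ### Poles -/

/-- `(∞, ∞)` is a pole of `r` on the curve associated with `p`. -/
def IsPoleAtInfty (r : Rat2 K) (p : Poly K) : Prop :=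
  ∃ φ : HahnSeries ℚ K, IsPuiseux φ ∧ MvPolynomial.aeval ![xSeries K, φ] p = 0 ∧
    0 < deg φ ∧ 0 < deg (evalAt (xSeries K) φ r)

/-- The fractional linear transformation `z ↦ (a z + b) / (c z + d)` applied to `z ∈ K(x, y)`. -/
def mobius (T : GL (Fin 2) K) (z : Rat2 K) : Rat2 K :=
  (algebraMap K (Rat2 K) (T 0 0) * z + algebraMap K (Rat2 K) (T 0 1)) /
    (algebraMap K (Rat2 K) (T 1 0) * z + algebraMap K (Rat2 K) (T 1 1))

/-- `r ∘ (T₁, T₂)`, that is `r(T₁(x), T₂(y))`. -/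
def compMobius (r : Rat2 K) (T₁ T₂ : GL (Fin 2) K) : Rat2 K :=
  evalAt (mobius T₁ (xvar K)) (mobius T₂ (yvar K)) r

open Classical in
/-- The point `s` of the curve associated with `p` is a pole of `r`: some transformation
`T = (T₁, T₂)` of `ℙ¹ × ℙ¹` maps `s` to `(∞, ∞)`, and the latter is a pole of `r ∘ T⁻¹` on the
curve associated with the numerator of `p ∘ T⁻¹`. -/
def IsPole (r : Rat2 K) (p : Poly K) (s : OnePoint K × OnePoint K) : Prop :=
  s ∈ curve p ∧ ∃ T₁ T₂ : GL (Fin 2) K,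
    T₁ • s.1 = OnePoint.infty ∧ T₂ • s.2 = OnePoint.infty ∧
    IsPoleAtInfty (compMobius r T₁⁻¹ T₂⁻¹)
      (numer (compMobius (algebraMap (Poly K) (Rat2 K) p) T₁⁻¹ T₂⁻¹))

/-! ### Orbits and their graphs -/

/-- Two points of the curve share a coordinate. -/
def ShareCoord {p : Poly K} (v w : curve p) : Prop := v.1.1 = w.1.1 ∨ v.1.2 = w.1.2

/-- The orbit of `s`: its class under the smallest equivalence relation on the curve that
relates any two points which share a coordinate. -/
def orbit (p : Poly K) (s : curve p) : Set (curve p) :=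
  {v | Relation.EqvGen ShareCoord s v}

/-- The graph of the orbit of `s`. -/
def orbitGraph (p : Poly K) (s : curve p) : SimpleGraph (orbit p s) where
  Adj v w := v ≠ w ∧ ShareCoord v.1 w.1
  symm := ⟨fun _ _ h => ⟨h.1.symm, h.2.imp Eq.symm Eq.symm⟩⟩
  loopless := ⟨fun _ h => h.1 rfl⟩

/-- An infinite path in a graph: consecutive vertices are adjacent. -/
def IsInfinitePath {V : Type*} (G : SimpleGraph V) (v : ℕ → V) : Prop :=
  ∀ i, G.Adj (v i) (v (i + 1))

/-- The path contains no cycle, a cycle being a part `v_i, …, v_j` with `i < j` and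
`v_i = v_j`. -/
def IsCycleFree {V : Type*} (v : ℕ → V) : Prop := ∀ i j, i < j → v i ≠ v j

/-- `v` is an infinite cycle-free path in the graph of the orbit of `s` that starts at `s` and
contains no pole of `r` other than `s`. -/
def IsAdmissiblePath (r : Rat2 K) (p : Poly K) (s : curve p) (v : ℕ → orbit p s) : Prop :=
  IsInfinitePath (orbitGraph p s) v ∧ IsCycleFree v ∧ (v 0).1 = s ∧
    ∀ i, IsPole r p (v i).1.1 → (v i).1 = s

end SepVar

end

/-!
Suppose that `(f, g) ∈ F(r, p)`. The rational functions `f` and `g` in one variable have finite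
sets `S` and `T` of poles in `ℙ¹(K)`, and `r` takes the value `f - g` along the curve. Hence a
pole `s` of `r` satisfies `s.1 ∈ S` or `s.2 ∈ T`, whereas at any other point of the curve the poles
of `f` and `g` have to cancel, so that `s.1 ∈ S` if and only if `s.2 ∈ T`. The latter needs a
Puiseux series through every point of the curve, which exists by the theorem of Newton and Puiseux:
a Tschirnhaus transformation and a rescaling of the roots turn a monic polynomial over `K⟦X⟧` into
one whose reduction has two distinct roots, and a factorisation over the complete local ring
`K⟦X⟧` then lowers the degree.

On a path that starts at `s` and meets no other pole, a step that preserves a coordinate carries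
the poles of `f` and `g` along. If the first step preserves the coordinate where `f` or `g` has a
pole, all further vertices lie in the finite set `S ×ˢ T`, and the path is not cycle-free.
-/

namespace SepVar

section NewtonPuiseuxTheorem

open Polynomial

/-! ### Factorisation of monic polynomials over complete local rings -/

section CompleteLocalRing

theorem order_coe_eq_natTrailingDegree {R : Type*} [CommRing R] {f : R[X]} (hf : f ≠ 0) :
    (f : PowerSeries R).order = f.natTrailingDegree := by
  refine PowerSeries.order_eq_nat.2 ⟨?_, fun i hi => ?_⟩
  · rwa [coeff_coe, ← trailingCoeff, Ne, trailingCoeff_eq_zero]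
  · rw [coeff_coe, coeff_eq_zero_of_lt_natTrailingDegree hi]

theorem map_eq_X_pow_of_le_ker {A B : Type*} [CommRing A] [CommRing B] {I : Ideal A} {g : A[X]}
    (hg : g.IsDistinguishedAt I) {φ : A →+* B} (hφ : I ≤ RingHom.ker φ) :
    g.map φ = X ^ g.natDegree := by
  ext i
  rw [coeff_map, coeff_X_pow]
  split_ifs with hi
  · rw [hi, hg.monic.coeff_natDegree, map_one]
  rcases lt_or_gt_of_ne hi with hlt | hgt
  · exact hφ (hg.mem hlt)
  · rw [coeff_eq_zero_of_natDegree_lt hgt, map_zero]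

variable {A : Type*} [CommRing A] [IsLocalRing A] [IsAdicComplete (IsLocalRing.maximalIdeal A) A]

theorem exists_isDistinguishedAt_dvd {q : A[X]} (hq : q.map (IsLocalRing.residue A) ≠ 0) :
    ∃ g : A[X], g.IsDistinguishedAt (IsLocalRing.maximalIdeal A) ∧ g ∣ q ∧
      g.natDegree = (q.map (IsLocalRing.residue A)).rootMultiplicity 0 := by
  have hq' : (q : PowerSeries A).map (IsLocalRing.residue A) ≠ 0 := by
    rw [← polynomial_map_coe]
    exact_mod_cast hq
  obtain ⟨g, h, hw⟩ := (q : PowerSeries A).exists_isWeierstrassFactorization hq'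
  refine ⟨g, hw.isDistinguishedAt, ?_, ?_⟩
  · rw [← Ideal.Quotient.eq_zero_iff_dvd, ← map_eq_zero_iff _ hw.algEquivQuotient.injective]
    simp
  · rw [hw.natDegree_eq_toNat_order_map, ← polynomial_map_coe, order_coe_eq_natTrailingDegree hq,
      ENat.toNat_natCast, rootMultiplicity_eq_natTrailingDegree']

theorem exists_monic_dvd_natDegree_eq_rootMultiplicity {f : A[X]} (hf : f.Monic) (a : A) :
    ∃ g : A[X], g.Monic ∧ g ∣ f ∧ g.natDegree =
      (f.map (IsLocalRing.residue A)).rootMultiplicity (IsLocalRing.residue A a) := by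
  have hmap : (taylor a f).map (IsLocalRing.residue A) =
      (f.map (IsLocalRing.residue A)).comp (X + C (IsLocalRing.residue A a)) := by
    rw [map_taylor, taylor_apply]
  obtain ⟨g, hg, hgf, hdeg⟩ := exists_isDistinguishedAt_dvd (q := taylor a f) (by
    rw [map_taylor]
    exact (map_ne_zero_iff _ (taylor_injective _)).2 (hf.map _).ne_zero)
  refine ⟨taylor (-a) g, (leadingCoeff_taylor _ g).trans hg.monic, ?_, ?_⟩
  · simpa [taylor_taylor] using map_dvd (taylorAlgHom (-a)) hgf
  · rw [natDegree_taylor, hdeg, hmap, ← rootMultiplicity_eq_rootMultiplicity]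

theorem eq_X_pow_of_rootMultiplicity_eq_natDegree {k : Type*} [Field k] [CharZero k] {f : k[X]}
    (hf : f.Monic) (hnext : f.nextCoeff = 0) {c : k}
    (hc : f.rootMultiplicity c = f.natDegree) : f = X ^ f.natDegree := by
  have hpow : f = (X - C c) ^ f.natDegree := by
    refine (eq_of_monic_of_dvd_of_natDegree_le ((monic_X_sub_C c).pow _) hf ?_ ?_)
    · exact hc ▸ pow_rootMultiplicity_dvd f c
    · simp
  rcases eq_or_ne f.natDegree 0 with h0 | h0
  · rw [h0, pow_zero, hf.natDegree_eq_zero.1 h0]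
  have hc0 : c = 0 := by
    rw [hpow, (monic_X_sub_C c).nextCoeff_pow, nextCoeff_X_sub_C] at hnext
    simpa [h0] using hnext
  rwa [hc0, C_0, sub_zero] at hpow

theorem exists_monic_dvd_natDegree_lt [IsAlgClosed (IsLocalRing.ResidueField A)]
    [CharZero (IsLocalRing.ResidueField A)] {f : A[X]} (hf : f.Monic) (hnext : f.nextCoeff = 0)
    (hred : f.map (IsLocalRing.residue A) ≠ X ^ f.natDegree) :
    ∃ g : A[X], g.Monic ∧ g ∣ f ∧ g.natDegree ≠ 0 ∧ g.natDegree < f.natDegree := by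
  set F := f.map (IsLocalRing.residue A)
  have hF : F.Monic := hf.map _
  have hFdeg : F.natDegree = f.natDegree := hf.natDegree_map _
  have hFnext : F.nextCoeff = 0 := by
    rw [nextCoeff_map_eq_of_isUnit_leadingCoeff _ (hf.leadingCoeff ▸ isUnit_one), hnext, map_zero]
  rw [← hFdeg] at hred
  have hFdeg0 : F.degree ≠ 0 := fun h => hred <| by
    rw [hF.degree_le_zero_iff_eq_one.1 h.le, natDegree_one, pow_zero]
  obtain ⟨c, hc⟩ := IsAlgClosed.exists_root F hFdeg0
  obtain ⟨a, rfl⟩ := IsLocalRing.residue_surjective c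
  have hle : F.rootMultiplicity (IsLocalRing.residue A a) ≤ F.natDegree := by
    simpa using natDegree_le_of_dvd (pow_rootMultiplicity_dvd F _) hF.ne_zero
  obtain ⟨g, hg, hgf, hgdeg⟩ := exists_monic_dvd_natDegree_eq_rootMultiplicity hf a
  refine ⟨g, hg, hgf, ?_, ?_⟩
  · rw [hgdeg]
    exact ((rootMultiplicity_pos hF.ne_zero).2 hc).ne'
  · rw [hgdeg, ← hFdeg]
    exact hle.lt_of_ne fun h => hred (eq_X_pow_of_rootMultiplicity_eq_natDegree hF hFnext h)

end CompleteLocalRing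

section Tschirnhaus

variable {R : Type*} [CommRing R]

theorem nextCoeff_taylor (r : R) (g : R[X]) :
    (taylor r g).nextCoeff = g.nextCoeff + g.natDegree * g.leadingCoeff * r := by
  rcases hd : g.natDegree with - | d
  · rw [eq_C_of_natDegree_eq_zero hd, taylor_C, nextCoeff_C_eq_zero]
    simp
  have hhasse : (hasseDeriv d g).natDegree < 2 := by
    have := natDegree_hasseDeriv_le g d
    omega
  rw [nextCoeff_of_natDegree_pos (by rw [natDegree_taylor]; omega),
    nextCoeff_of_natDegree_pos (by omega), natDegree_taylor, hd, Nat.add_sub_cancel, taylor_coeff,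
    eval_eq_sum_range' hhasse, Finset.sum_range_succ, Finset.sum_range_one, hasseDeriv_coeff,
    hasseDeriv_coeff, leadingCoeff, hd]
  simp [add_comm 1 d]

theorem exists_nextCoeff_taylor_eq_zero {g : R[X]} (hg : g.Monic)
    (hdeg : IsUnit (g.natDegree : R)) : ∃ r : R, (taylor r g).nextCoeff = 0 := by
  obtain ⟨s, hs⟩ := hdeg.exists_right_inv
  refine ⟨-(s * g.nextCoeff), ?_⟩
  rw [nextCoeff_taylor, hg.leadingCoeff]
  linear_combination -g.nextCoeff * hs

end Tschirnhaus

/-! ### Puiseux roots of polynomials over power series rings -/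

section ScaleRoots

variable {R : Type*} [CommRing R]

theorem nextCoeff_scaleRoots (f : R[X]) (s : R) :
    (scaleRoots f s).nextCoeff = f.nextCoeff * s := by
  rcases hd : f.natDegree with - | d
  · rw [eq_C_of_natDegree_eq_zero hd, scaleRoots_C, nextCoeff_C_eq_zero, zero_mul]
  rw [nextCoeff_of_natDegree_pos (by rw [natDegree_scaleRoots]; omega),
    nextCoeff_of_natDegree_pos (by omega), natDegree_scaleRoots, coeff_scaleRoots,
    Nat.sub_sub_self (by omega), pow_one]

theorem exists_scaleRoots_eq {f : R[X]} (hf : f.Monic) {s : R}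
    (hdvd : ∀ i < f.natDegree, s ^ (f.natDegree - i) ∣ f.coeff i) :
    ∃ g : R[X], g.Monic ∧ scaleRoots g s = f := by
  nontriviality R
  choose! b hb using hdvd
  set d := f.natDegree
  have hlt : (∑ i ∈ Finset.range d, monomial i (b i)).degree < (d : WithBot ℕ) :=
    (degree_sum_le _ _).trans_lt <| (Finset.sup_lt_iff (WithBot.bot_lt_coe d)).2 fun i hi =>
      (degree_monomial_le i _).trans_lt (WithBot.coe_lt_coe.2 (Finset.mem_range.1 hi))
  set g := X ^ d + ∑ i ∈ Finset.range d, monomial i (b i)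
  have hg : g.Monic := monic_X_pow_add hlt
  have hgd : g.natDegree = d := natDegree_eq_of_degree_eq_some <| by
    rw [degree_add_eq_left_of_degree_lt (by rwa [degree_X_pow]), degree_X_pow]
  refine ⟨g, hg, ?_⟩
  ext i
  rw [coeff_scaleRoots, hgd]
  rcases lt_trichotomy i d with hi | rfl | hi
  · simp [g, hb i hi, coeff_X_pow, hi.ne, finsetSum_coeff, coeff_monomial, hi, mul_comm]
  · rw [Nat.sub_self, pow_zero, mul_one, hf.coeff_natDegree, ← hgd, hg.coeff_natDegree]
  · rw [coeff_eq_zero_of_natDegree_lt (hgd.trans_lt hi), coeff_eq_zero_of_natDegree_lt hi, zero_mul]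

end ScaleRoots

/-- The lower hull of the points `(i, w i)` and `(d, 0)` has an edge ending in `(d, 0)`. -/
theorem exists_minimal_slope {d : ℕ} (w : ℕ → ℕ∞) (hw : ∃ i < d, w i ≠ ⊤) :
    ∃ i₀ < d, ∃ k : ℕ, w i₀ = k ∧ ∀ i < d, ((k * (d - i) : ℕ) : ℕ∞) ≤ (d - i₀ : ℕ) * w i := by
  classical
  obtain ⟨i₀, hi₀, hmin⟩ := Finset.exists_min_image ((Finset.range d).filter fun i => w i ≠ ⊤)
    (fun i => ((w i).toNat : ℚ) / (d - i : ℕ))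
    (by obtain ⟨i, hi, h⟩ := hw; exact ⟨i, by simp [hi, h]⟩)
  simp only [Finset.mem_filter, Finset.mem_range] at hi₀ hmin
  refine ⟨i₀, hi₀.1, (w i₀).toNat, (ENat.natCast_toNat hi₀.2).symm, fun i hi => ?_⟩
  have hpos : ∀ j < d, (0 : ℚ) < (d - j : ℕ) := fun j hj => by
    exact_mod_cast Nat.sub_pos_of_lt hj
  rcases eq_or_ne (w i) ⊤ with htop | htop
  · rw [htop, ENat.mul_top (by exact_mod_cast (Nat.sub_pos_of_lt hi₀.1).ne')]
    exact le_top
  have hle := hmin i ⟨hi, htop⟩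
  rw [div_le_div_iff₀ (hpos i₀ hi₀.1) (hpos i hi), mul_comm ((w i).toNat : ℚ)] at hle
  rw [← ENat.natCast_toNat htop]
  exact_mod_cast hle

section NewtonPuiseux

variable {K : Type*} [Field K]

instance isAdicComplete_powerSeries :
    IsAdicComplete (IsLocalRing.maximalIdeal (PowerSeries K)) (PowerSeries K) := by
  rw [PowerSeries.maximalIdeal_eq_span_X]
  infer_instance

instance isAlgClosed_residueField_powerSeries [IsAlgClosed K] :
    IsAlgClosed (IsLocalRing.ResidueField (PowerSeries K)) :=
  IsAlgClosed.of_ringEquiv _ _ (PowerSeries.residueFieldOfPowerSeries (k := K)).symm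

instance charZero_residueField_powerSeries [CharZero K] :
    CharZero (IsLocalRing.ResidueField (PowerSeries K)) :=
  charZero_of_injective_ringHom
    (PowerSeries.residueFieldOfPowerSeries (k := K)).symm.toRingHom.injective

theorem residue_powerSeries_eq_zero_iff (a : PowerSeries K) :
    IsLocalRing.residue (PowerSeries K) a = 0 ↔ PowerSeries.constantCoeff a = 0 := by
  rw [IsLocalRing.residue_eq_zero_iff, ← PowerSeries.ker_coeff_eq_max_ideal, RingHom.mem_ker]

theorem exists_scaleRoots_eq_map_expand {g : (PowerSeries K)[X]} (hg : g.Monic)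
    (h0 : ∃ i < g.natDegree, g.coeff i ≠ 0) :
    ∃ (n : ℕ) (hn : n ≠ 0) (s : PowerSeries K) (f : (PowerSeries K)[X]), s ≠ 0 ∧ f.Monic ∧
      scaleRoots f s = g.map (PowerSeries.expand (R := K) n hn).toRingHom ∧
      f.map (IsLocalRing.residue (PowerSeries K)) ≠ X ^ f.natDegree := by
  obtain ⟨i₀, hi₀, k, hk, hle⟩ := exists_minimal_slope (fun i => (g.coeff i).order)
    (by simpa only [ne_eq, PowerSeries.order_eq_top] using h0)
  have hn : g.natDegree - i₀ ≠ 0 := (Nat.sub_pos_of_lt hi₀).ne'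
  set e := (PowerSeries.expand (R := K) (g.natDegree - i₀) hn).toRingHom
  have horder : ∀ i, (e (g.coeff i)).order = (g.natDegree - i₀ : ℕ) * (g.coeff i).order :=
    fun i => (PowerSeries.order_expand _ hn _).trans (nsmul_eq_mul _ _)
  have hdeg : (g.map e).natDegree = g.natDegree := hg.natDegree_map e
  obtain ⟨f, hf, hfs⟩ := exists_scaleRoots_eq (hg.map e) (s := PowerSeries.X ^ k) fun i hi => by
    rw [hdeg] at hi ⊢
    rw [coeff_map, ← pow_mul]
    refine PowerSeries.X_pow_dvd_iff.2 fun m hm => PowerSeries.coeff_of_lt_order m ?_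
    rw [horder]
    exact (Nat.cast_lt.2 hm).trans_le (hle i hi)
  refine ⟨_, hn, PowerSeries.X ^ k, f, pow_ne_zero _ PowerSeries.X_ne_zero, hf, hfs, fun hres => ?_⟩
  have hfdeg : f.natDegree = g.natDegree := by rw [← hdeg, ← hfs, natDegree_scaleRoots]
  have hcoeff : f.coeff i₀ * PowerSeries.X ^ (k * (g.natDegree - i₀)) = e (g.coeff i₀) := by
    rw [← coeff_map, ← hfs, coeff_scaleRoots, hfdeg, pow_mul]
  have hfi₀ : (f.coeff i₀).order = 0 := by
    have h := congr_arg PowerSeries.order hcoeff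
    rw [PowerSeries.order_mul, PowerSeries.order_X_pow, horder, hk, mul_comm, ← Nat.cast_mul,
      mul_comm] at h
    exact WithTop.add_right_cancel (ENat.natCast_ne_top _) (h.trans (zero_add _).symm)
  apply PowerSeries.order_ne_zero_iff_constCoeff_eq_zero.2 _ hfi₀
  rw [← residue_powerSeries_eq_zero_iff, ← coeff_map, hres, hfdeg, coeff_X_pow, if_neg hi₀.ne]

/-- A polynomial over `K⟦X⟧` has a Puiseux root if it has a root in `K⟦X ^ (1 / n)⟧` for some
`n ≠ 0`. The latter ring is encoded as the `K⟦X⟧`-algebra `K⟦X⟧` with structure map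
`X ↦ X ^ n`. -/
def HasPuiseuxRoot (g : (PowerSeries K)[X]) : Prop :=
  ∃ (n : ℕ) (hn : n ≠ 0) (z : PowerSeries K),
    eval₂ (PowerSeries.expand (R := K) n hn).toRingHom z g = 0

namespace HasPuiseuxRoot

variable {f g : (PowerSeries K)[X]}

theorem of_dvd (h : HasPuiseuxRoot g) (hgf : g ∣ f) : HasPuiseuxRoot f := by
  obtain ⟨n, hn, z, hz⟩ := h
  exact ⟨n, hn, z, eval₂_eq_zero_of_dvd_of_eval₂_eq_zero _ _ hgf hz⟩

theorem of_taylor {r : PowerSeries K} (h : HasPuiseuxRoot (taylor r g)) : HasPuiseuxRoot g := by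
  obtain ⟨n, hn, z, hz⟩ := h
  rw [taylor_apply, eval₂_comp] at hz
  exact ⟨n, hn, _, hz⟩

theorem of_scaleRoots {n : ℕ} {hn : n ≠ 0} {s : PowerSeries K} (h : HasPuiseuxRoot f)
    (hs : scaleRoots f s = g.map (PowerSeries.expand (R := K) n hn).toRingHom) :
    HasPuiseuxRoot g := by
  obtain ⟨m, hm, z, hz⟩ := h
  have hroot := scaleRoots_eval₂_eq_zero _ (s := s) hz
  rw [hs, eval₂_map] at hroot
  have hcomp : (PowerSeries.expand (R := K) m hm).toRingHom.comp
      (PowerSeries.expand n hn).toRingHom =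
      (PowerSeries.expand (m * n) (mul_ne_zero hm hn)).toRingHom :=
    RingHom.ext fun a => (PowerSeries.expand_mul m hm n hn a).symm
  exact ⟨m * n, _, _, hcomp ▸ hroot⟩

end HasPuiseuxRoot

variable [IsAlgClosed K] [CharZero K]

theorem hasPuiseuxRoot_of_monic {g : (PowerSeries K)[X]} (hg : g.Monic) (hdeg : g.natDegree ≠ 0) :
    HasPuiseuxRoot g := by
  induction hD : g.natDegree using Nat.strong_induction_on generalizing g with
  | _ D IH =>
  subst hD
  have hunit : IsUnit (g.natDegree : PowerSeries K) := by
    rw [PowerSeries.isUnit_iff_constantCoeff, map_natCast]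
    exact (Nat.cast_ne_zero.2 hdeg).isUnit
  obtain ⟨r, hr⟩ := exists_nextCoeff_taylor_eq_zero hg hunit
  refine HasPuiseuxRoot.of_taylor (r := r) ?_
  have ht : (taylor r g).Monic := (leadingCoeff_taylor r g).trans hg
  by_cases h0 : (taylor r g).coeff 0 = 0
  · exact ⟨1, one_ne_zero, 0, by rw [eval₂_at_zero, h0, map_zero]⟩
  obtain ⟨n, hn, s, f, hs, hf, hfs, hred⟩ := exists_scaleRoots_eq_map_expand ht
    ⟨0, by rw [natDegree_taylor]; exact Nat.pos_of_ne_zero hdeg, h0⟩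
  have hfnext : f.nextCoeff = 0 := by
    have h := nextCoeff_scaleRoots f s
    rw [hfs, nextCoeff_map_eq_of_isUnit_leadingCoeff _ (ht.leadingCoeff ▸ isUnit_one), hr,
      map_zero] at h
    exact (mul_eq_zero.1 h.symm).resolve_right hs
  have hfdeg : f.natDegree = g.natDegree := by
    rw [← natDegree_scaleRoots f s, hfs, ht.natDegree_map, natDegree_taylor]
  obtain ⟨G, hG, hGf, hG0, hGlt⟩ := exists_monic_dvd_natDegree_lt hf hfnext hred
  exact ((IH _ (hGlt.trans_eq hfdeg) hG hG0 rfl).of_dvd hGf).of_scaleRoots hfs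

theorem exists_puiseux_root_constantCoeff_eq_zero {q : (PowerSeries K)[X]}
    (hq : q.map (PowerSeries.constantCoeff (R := K)) ≠ 0)
    (hq0 : PowerSeries.constantCoeff (q.coeff 0) = 0) :
    ∃ (n : ℕ) (hn : n ≠ 0) (z : PowerSeries K), PowerSeries.constantCoeff z = 0 ∧
      eval₂ (PowerSeries.expand (R := K) n hn).toRingHom z q = 0 := by
  have hres : q.map (IsLocalRing.residue (PowerSeries K)) ≠ 0 := fun h => hq <| by
    ext i
    rw [coeff_map, coeff_zero, ← residue_powerSeries_eq_zero_iff, ← coeff_map, h, coeff_zero]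
  obtain ⟨g, hg, hgq, hgdeg⟩ := exists_isDistinguishedAt_dvd hres
  have hg0 : g.natDegree ≠ 0 := by
    rw [hgdeg]
    refine ((rootMultiplicity_pos hres).2 ?_).ne'
    rwa [IsRoot, ← coeff_zero_eq_eval_zero, coeff_map, residue_powerSeries_eq_zero_iff]
  obtain ⟨n, hn, z, hz⟩ := hasPuiseuxRoot_of_monic hg.monic hg0
  refine ⟨n, hn, z, ?_, eval₂_eq_zero_of_dvd_of_eval₂_eq_zero _ _ hgq hz⟩
  have hcomp : (PowerSeries.constantCoeff (R := K)).comp (PowerSeries.expand n hn).toRingHom =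
      PowerSeries.constantCoeff := RingHom.ext (PowerSeries.constantCoeff_expand n hn)
  have hpow := congr_arg (PowerSeries.constantCoeff (R := K)) hz
  rw [hom_eval₂, hcomp, ← eval_map,
    map_eq_X_pow_of_le_ker hg PowerSeries.ker_coeff_eq_max_ideal.ge, eval_pow, eval_X,
    map_zero] at hpow
  exact (pow_eq_zero_iff hg0).1 hpow

end NewtonPuiseux

end NewtonPuiseuxTheorem

/-! ### The field of Puiseux series in `x⁻¹` -/

section PuiseuxSeries

variable {K : Type*} [Field K]

variable (K) in
/-- The valuation of `HahnSeries ℚ K` given by the order in `x⁻¹`, written multiplicatively, so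
that a series of positive degree in `x` has a value larger than `1`. -/
noncomputable def hahnVal : Valuation (HahnSeries ℚ K) (Multiplicative (WithTop ℚ)ᵒᵈ) :=
  (HahnSeries.addVal ℚ K).toValuation

theorem hahnVal_le_one_iff (φ : HahnSeries ℚ K) : hahnVal K φ ≤ 1 ↔ 0 ≤ φ.orderTop :=
  Iff.rfl

theorem zero_lt_deg_iff (φ : HahnSeries ℚ K) : 0 < deg φ ↔ 1 < hahnVal K φ := by
  rw [← not_le, ← not_le, not_iff_not, hahnVal_le_one_iff, HahnSeries.zero_le_orderTop_iff, deg]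
  split_ifs with h
  · simp [h]
  · rw [← WithBot.coe_zero, WithBot.coe_le_coe, neg_nonpos]

theorem algebraMap_hahnSeries (c : K) : algebraMap K (HahnSeries ℚ K) c = HahnSeries.C c := by
  rw [HahnSeries.algebraMap_apply', PowerSeries.algebraMap_apply, Algebra.algebraMap_self_apply,
    HahnSeries.ofPowerSeries_C]

instance isTrivialOn_hahnVal : (hahnVal K).IsTrivialOn K :=
  .of_le_one _ fun c => by
    rw [hahnVal_le_one_iff, algebraMap_hahnSeries]
    exact HahnSeries.orderTop_single_le

theorem one_lt_hahnVal_xSeries : 1 < hahnVal K (xSeries K) := by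
  rw [← not_le, hahnVal_le_one_iff, xSeries, HahnSeries.orderTop_single one_ne_zero]
  decide

/-- The embedding of the field of Laurent series in `X` into the Puiseux series in `x⁻¹` that maps
`X` to `x ^ (-1 / n)`. -/
noncomputable def laurentHom (n : ℕ) (hn : n ≠ 0) : HahnSeries ℤ K →+* HahnSeries ℚ K :=
  HahnSeries.embDomainRingHom ((AddMonoidHom.mulRight (n : ℚ)⁻¹).comp (Int.castAddHom ℚ))
    (fun i j h => by simpa [hn] using h)
    (fun i j => by
      have hpos : (0 : ℚ) < (n : ℚ)⁻¹ := inv_pos.2 (by exact_mod_cast Nat.pos_of_ne_zero hn)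
      simp [mul_le_mul_iff_left₀ hpos])

/-- The embedding of `K⟦X⟧` into the Puiseux series in `x⁻¹` that maps `X` to `x ^ (-1 / n)`. -/
noncomputable def puiseuxHom (n : ℕ) (hn : n ≠ 0) : PowerSeries K →+* HahnSeries ℚ K :=
  (laurentHom n hn).comp (HahnSeries.ofPowerSeries ℤ K)

variable (n : ℕ) (hn : n ≠ 0)

theorem isPuiseux_laurentHom (a : HahnSeries ℤ K) : IsPuiseux (laurentHom n hn a) := by
  refine ⟨n, Nat.pos_of_ne_zero hn, fun q hq => ?_⟩
  obtain ⟨m, -, rfl⟩ := HahnSeries.support_embDomain_subset hq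
  exact ⟨m, (div_eq_mul_inv _ _).symm⟩

theorem isPuiseux_inv_puiseuxHom (z : PowerSeries K) : IsPuiseux (puiseuxHom n hn z)⁻¹ := by
  rw [puiseuxHom, RingHom.comp_apply, ← map_inv₀]
  exact isPuiseux_laurentHom n hn _

theorem puiseuxHom_C (c : K) :
    puiseuxHom n hn (PowerSeries.C c) = algebraMap K (HahnSeries ℚ K) c := by
  rw [puiseuxHom, RingHom.comp_apply, HahnSeries.ofPowerSeries_C, algebraMap_hahnSeries]
  exact HahnSeries.embDomainRingHom_C

theorem puiseuxHom_X_pow :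
    puiseuxHom n hn (PowerSeries.X ^ n : PowerSeries K) = (xSeries K)⁻¹ := by
  rw [puiseuxHom, RingHom.comp_apply, HahnSeries.ofPowerSeries_X_pow, xSeries,
    HahnSeries.inv_single, inv_one, neg_neg]
  exact HahnSeries.embDomain_single.trans (by simp [hn])

theorem hahnVal_puiseuxHom_le_one (z : PowerSeries K) : hahnVal K (puiseuxHom n hn z) ≤ 1 := by
  rw [hahnVal_le_one_iff, HahnSeries.le_orderTop_iff_forall]
  intro q hq
  by_contra hne
  obtain ⟨m, hm, rfl⟩ := HahnSeries.support_embDomain_subset hne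
  obtain ⟨i, -, rfl⟩ := HahnSeries.support_embDomain_subset hm
  refine (WithTop.coe_lt_coe.1 hq).not_ge ?_
  change (0 : ℚ) ≤ ((i : ℤ) : ℚ) * (n : ℚ)⁻¹
  positivity

theorem hahnVal_puiseuxHom_lt_one {z : PowerSeries K} (hz : PowerSeries.constantCoeff z = 0) :
    hahnVal K (puiseuxHom n hn z) < 1 := by
  obtain ⟨w, rfl⟩ := PowerSeries.X_dvd_iff.2 hz
  have hX : hahnVal K (puiseuxHom n hn PowerSeries.X) < 1 := by
    refine (pow_lt_one_iff hn).1 ?_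
    rw [← map_pow, ← map_pow, puiseuxHom_X_pow, map_inv₀]
    exact inv_lt_one_of_one_lt₀ one_lt_hahnVal_xSeries
  rw [map_mul, map_mul]
  exact mul_lt_one_of_lt_of_le hX (hahnVal_puiseuxHom_le_one n hn w)

end PuiseuxSeries

/-! ### Centers of valuations on the projective line -/

section Center

variable {K L Γ : Type*} [Field K] [Field L] [Algebra K L] [LinearOrderedCommGroupWithZero Γ]

/-- The element `z` of a valued field is centered at the point `a` of the projective line, that
is, it reduces to `a` in the residue field, a value larger than `1` being a reduction to `∞`. -/
def IsCenter (ν : Valuation L Γ) (z : L) : OnePoint K → Prop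
  | none => 1 < ν z
  | some c => ν (z - algebraMap K L c) < 1

theorem one_lt_or_one_lt_of_one_lt_sub (ν : Valuation L Γ) {a b : L} (h : 1 < ν (a - b)) :
    1 < ν a ∨ 1 < ν b := by
  by_contra! hab
  exact (ν.map_sub_le hab.1 hab.2).not_gt h

theorem one_lt_iff_of_sub_le_one (ν : Valuation L Γ) {a b : L} (h : ν (a - b) ≤ 1) :
    1 < ν a ↔ 1 < ν b := by
  rw [← not_le, ← not_le, not_iff_not]
  constructor
  · intro ha
    rw [← sub_sub_cancel a b]
    exact ν.map_sub_le ha h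
  · intro hb
    rw [← sub_add_cancel a b]
    exact ν.map_add_le h hb

variable {ν : Valuation L Γ} [ν.IsTrivialOn K]

variable (K) in
theorem transcendental_of_one_lt {z : L} (hz : 1 < ν z) : Transcendental K z :=
  Valuation.transcendental_of_ne_one (v := ν) K z (ν.ne_zero_iff.1 (zero_lt_one.trans hz).ne')
    hz.ne'

section Polynomial

variable {c : K} {z : L}

theorem valuation_aeval_le_one (A : Polynomial K) (hz : ν z ≤ 1) :
    ν (Polynomial.aeval z A) ≤ 1 := by
  rw [Polynomial.aeval_eq_sum_range]
  refine ν.map_sum_le fun i _ => ?_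
  rw [Algebra.smul_def, map_mul, map_pow]
  exact mul_le_one' (Valuation.IsTrivialOn.valuation_algebraMap_le_one ν _) (pow_le_one' hz _)

theorem valuation_le_one_of_sub_algebraMap_lt_one (hz : ν (z - algebraMap K L c) < 1) :
    ν z ≤ 1 := by
  rw [← sub_add_cancel z (algebraMap K L c)]
  exact ν.map_add_le hz.le (Valuation.IsTrivialOn.valuation_algebraMap_le_one ν c)

theorem valuation_aeval_sub_eval_lt_one (A : Polynomial K) (hz : ν (z - algebraMap K L c) < 1) :
    ν (Polynomial.aeval z A - algebraMap K L (A.eval c)) < 1 := by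
  obtain ⟨B, hB⟩ := Polynomial.X_sub_C_dvd_sub_C_eval (p := A) (a := c)
  have hAB := congr_arg (Polynomial.aeval z) hB
  simp only [map_sub, map_mul, Polynomial.aeval_C, Polynomial.aeval_X] at hAB
  rw [hAB, map_mul]
  exact mul_lt_one_of_lt_of_le hz
    (valuation_aeval_le_one B (valuation_le_one_of_sub_algebraMap_lt_one hz))

theorem valuation_aeval_lt_one_iff (A : Polynomial K) (hz : ν (z - algebraMap K L c) < 1) :
    ν (Polynomial.aeval z A) < 1 ↔ A.eval c = 0 := by
  have h := valuation_aeval_sub_eval_lt_one A hz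
  by_cases hc : A.eval c = 0
  · rw [hc, map_zero, sub_zero] at h
    exact iff_of_true h hc
  · have hone : ν (algebraMap K L (A.eval c)) = 1 := Valuation.IsTrivialOn.eq_one _ hc
    rw [← hone] at h
    exact iff_of_false (ν.map_eq_of_sub_lt h ▸ hone.not_lt) hc

variable {A B : Polynomial K}

theorem one_lt_valuation_aeval_div_iff_of_one_lt (hB : B ≠ 0) (hz : 1 < ν z) :
    1 < ν (Polynomial.aeval z A / Polynomial.aeval z B) ↔ B.natDegree < A.natDegree := by
  rcases eq_or_ne A 0 with rfl | hA
  · simp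
  rw [map_div₀,
    Polynomial.valuation_aeval_eq_valuation_X_pow_natDegree_of_one_lt_valuation_X z hz hA,
    Polynomial.valuation_aeval_eq_valuation_X_pow_natDegree_of_one_lt_valuation_X z hz hB,
    one_lt_div₀ (pow_pos (zero_lt_one.trans hz) _)]
  exact pow_lt_pow_iff_right₀ hz

theorem one_lt_valuation_aeval_div_iff_of_sub_lt_one (hAB : IsCoprime A B)
    (hz : ν (z - algebraMap K L c) < 1) (hBz : Polynomial.aeval z B ≠ 0) :
    1 < ν (Polynomial.aeval z A / Polynomial.aeval z B) ↔ B.eval c = 0 := by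
  have hle (P : Polynomial K) : ν (Polynomial.aeval z P) ≤ 1 :=
    valuation_aeval_le_one P (valuation_le_one_of_sub_algebraMap_lt_one hz)
  rw [map_div₀, one_lt_div₀ (ν.pos_iff.2 hBz), ← valuation_aeval_lt_one_iff B hz]
  refine ⟨fun h => h.trans_le (hle A), fun hB => hB.trans_eq (Eq.symm ?_)⟩
  refine (hle A).eq_of_not_lt fun hA => ?_
  rw [valuation_aeval_lt_one_iff _ hz] at hA hB
  obtain ⟨u, v, huv⟩ := hAB
  simpa [hA, hB] using congr_arg (Polynomial.eval c) huv

variable (ν) in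
theorem exists_finite_poles (hAB : IsCoprime A B) (hB : B ≠ 0) :
    ∃ S : Set (OnePoint K), S.Finite ∧ ∀ (a : OnePoint K) (z : L), IsCenter ν z a →
      Polynomial.aeval z B ≠ 0 →
      (1 < ν (Polynomial.aeval z A / Polynomial.aeval z B) ↔ a ∈ S) := by
  refine ⟨{a | a = OnePoint.infty ∧ B.natDegree < A.natDegree} ∪
    (fun c : K => (c : OnePoint K)) '' {c | B.eval c = 0}, ?_, fun a z hz hBz => ?_⟩
  · exact ((Set.finite_singleton OnePoint.infty).subset fun a h => h.1).union
      ((Polynomial.finite_setOfPred_isRoot hB).image _)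
  induction a using OnePoint.rec with
  | infty => simpa using one_lt_valuation_aeval_div_iff_of_one_lt hB hz
  | coe c => simpa using one_lt_valuation_aeval_div_iff_of_sub_lt_one hAB hz hBz

end Polynomial

theorem exists_isCoprime_aeval_div_eq_of_mem_adjoin {x f : L}
    (hf : f ∈ IntermediateField.adjoin K {x}) :
    ∃ A B : Polynomial K, IsCoprime A B ∧ B ≠ 0 ∧
      f = Polynomial.aeval x A / Polynomial.aeval x B := by
  obtain ⟨A, B, rfl⟩ := (IntermediateField.mem_adjoin_simple_iff K f).1 hf
  by_cases hB : Polynomial.aeval x B = 0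
  · exact ⟨0, 1, isCoprime_one_right, one_ne_zero, by simp [hB]⟩
  obtain ⟨A', B', D, hAB, rfl, rfl⟩ :=
    UniqueFactorizationMonoid.exists_reduced_factors' A B (ne_zero_of_map hB)
  rw [map_mul] at hB
  refine ⟨A', B', hAB.isCoprime, ne_zero_of_map (right_ne_zero_of_mul hB), ?_⟩
  rw [map_mul, map_mul, mul_div_mul_left _ _ (left_ne_zero_of_mul hB)]

end Center

/-! ### Fractional linear transformations -/

section FracLinear

variable {K L Γ : Type*} [Field K] [Field L] [Algebra K L] [LinearOrderedCommGroupWithZero Γ]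

/-- The fractional linear transformation `z ↦ (a z + b) / (c z + d)` of an extension field of `K`;
its value is `0` at the zero of the denominator. -/
def fracLinear (T : GL (Fin 2) K) (z : L) : L :=
  (algebraMap K L (T 0 0) * z + algebraMap K L (T 0 1)) /
    (algebraMap K L (T 1 0) * z + algebraMap K L (T 1 1))

theorem fracLinear_one (z : L) : fracLinear (1 : GL (Fin 2) K) z = z := by
  simp [fracLinear]

theorem fracLinear_mul (S T : GL (Fin 2) K) {z : L}
    (hz : algebraMap K L (T 1 0) * z + algebraMap K L (T 1 1) ≠ 0) :
    fracLinear (S * T) z = fracLinear S (fracLinear T z) := by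
  have hrow (i : Fin 2) : algebraMap K L (S i 0) * fracLinear T z + algebraMap K L (S i 1) =
      (algebraMap K L ((S * T) i 0) * z + algebraMap K L ((S * T) i 1)) /
        (algebraMap K L (T 1 0) * z + algebraMap K L (T 1 1)) := by
    rw [fracLinear, eq_div_iff hz, add_mul, mul_assoc, div_mul_cancel₀ _ hz]
    simp only [Matrix.GeneralLinearGroup.coe_mul, Matrix.mul_apply, Fin.sum_univ_two, map_add,
      map_mul]
    ring
  rw [fracLinear, fracLinear, hrow, hrow, div_div_div_cancel_right₀ hz]

theorem isAlgebraic_fracLinear (T : GL (Fin 2) K) {z : L} (hz : IsAlgebraic K z) :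
    IsAlgebraic K (fracLinear T z) := by
  have hrow (i : Fin 2) :
      IsAlgebraic K (algebraMap K L (T i 0) * z + algebraMap K L (T i 1)) :=
    ((isAlgebraic_algebraMap _).mul hz).add (isAlgebraic_algebraMap _)
  rw [fracLinear, div_eq_mul_inv]
  exact (hrow 0).mul (hrow 1).inv

variable {ν : Valuation L Γ} [ν.IsTrivialOn K]

theorem valuation_linear_eq {a b : K} (ha : a ≠ 0) {z : L} (hz : 1 < ν z) :
    ν (algebraMap K L a * z + algebraMap K L b) = ν z := by
  have haz : ν (algebraMap K L a * z) = ν z := by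
    rw [map_mul, Valuation.IsTrivialOn.eq_one a ha, one_mul]
  rw [ν.map_add_eq_of_lt_left, haz]
  exact (Valuation.IsTrivialOn.valuation_algebraMap_le_one ν b).trans_lt (hz.trans_eq haz.symm)

theorem fracLinear_denom_ne_zero (T : GL (Fin 2) K) {z : L} (hz : 1 < ν z) :
    algebraMap K L (T 1 0) * z + algebraMap K L (T 1 1) ≠ 0 := by
  by_cases h10 : T 1 0 = 0
  · have hdet := T.det_ne_zero
    rw [Matrix.det_fin_two, h10, mul_zero, sub_zero] at hdet
    simpa [h10] using right_ne_zero_of_mul hdet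
  · rw [← ν.ne_zero_iff, valuation_linear_eq h10 hz]
    exact (zero_lt_one.trans hz).ne'

theorem transcendental_fracLinear (T : GL (Fin 2) K) {z : L} (hz : 1 < ν z) :
    Transcendental K (fracLinear T z) := fun halg => by
  have hinv := isAlgebraic_fracLinear T⁻¹ halg
  rw [← fracLinear_mul _ _ (fracLinear_denom_ne_zero T hz), inv_mul_cancel, fracLinear_one] at hinv
  exact transcendental_of_one_lt K hz hinv

theorem isCenter_fracLinear [DecidableEq K] (T : GL (Fin 2) K) {z : L} (hz : 1 < ν z) :
    IsCenter ν (fracLinear T z) (T • (OnePoint.infty : OnePoint K)) := by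
  have hdet := T.det_ne_zero
  rw [Matrix.det_fin_two] at hdet
  have hdenom := fracLinear_denom_ne_zero T hz
  rw [OnePoint.smul_infty_eq_ite]
  split_ifs with h10
  · rw [h10, mul_zero, sub_zero] at hdet
    change 1 < ν (fracLinear T z)
    rwa [fracLinear, map_div₀, valuation_linear_eq (left_ne_zero_of_mul hdet) hz, h10, map_zero,
      zero_mul, zero_add, Valuation.IsTrivialOn.eq_one _ (right_ne_zero_of_mul hdet), div_one]
  · change ν (fracLinear T z - algebraMap K L (T 0 0 / T 1 0)) < 1
    have hdiff : fracLinear T z - algebraMap K L (T 0 0 / T 1 0) =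
        algebraMap K L (T 0 1 - T 1 1 * (T 0 0 / T 1 0)) /
          (algebraMap K L (T 1 0) * z + algebraMap K L (T 1 1)) := by
      have h10' : algebraMap K L (T 1 0) ≠ 0 := by simpa using h10
      rw [fracLinear, eq_div_iff hdenom, sub_mul, div_mul_cancel₀ _ hdenom]
      simp only [map_sub, map_mul, map_div₀]
      field_simp
      ring
    rw [hdiff, map_div₀, valuation_linear_eq h10 hz, div_lt_one₀ (zero_lt_one.trans hz)]
    exact (Valuation.IsTrivialOn.valuation_algebraMap_le_one ν _).trans_lt hz

end FracLinear

/-! ### Values of rational functions -/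

section Value

open MvPolynomial

variable {K L : Type*} [Field K] [Field L] [Algebra K L]

/-- The rational function `ρ` has a denominator that does not vanish at the point `x`, and its
value there is `z`. The fraction that exhibits the value need not be reduced. -/
def HasValue (x : Fin 2 → L) (ρ : Rat2 K) (z : L) : Prop :=
  ∃ N D : Poly K, aeval x D ≠ 0 ∧
    ρ = algebraMap (Poly K) (Rat2 K) N / algebraMap (Poly K) (Rat2 K) D ∧
    z = aeval x N / aeval x D

variable {x : Fin 2 → L} {ρ σ : Rat2 K} {z w : L}

theorem algebraMap_ne_zero_of_aeval_ne_zero {D : Poly K} (h : aeval x D ≠ 0) :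
    algebraMap (Poly K) (Rat2 K) D ≠ 0 := by
  simpa using ne_zero_of_map h

theorem hasValue_algebraMap (N : Poly K) :
    HasValue x (algebraMap (Poly K) (Rat2 K) N) (aeval x N) :=
  ⟨N, 1, by simp, by simp, by simp⟩

theorem hasValue_const (c : K) : HasValue x (algebraMap K (Rat2 K) c) (algebraMap K L c) := by
  have h := hasValue_algebraMap (x := x) (C c : Poly K)
  rwa [aeval_C, ← MvPolynomial.algebraMap_eq, ← IsScalarTower.algebraMap_apply] at h

theorem hasValue_X (i : Fin 2) : HasValue x (algebraMap (Poly K) (Rat2 K) (X i)) (x i) := by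
  simpa only [aeval_X] using hasValue_algebraMap (x := x) (X i : Poly K)

theorem HasValue.add (hρ : HasValue x ρ z) (hσ : HasValue x σ w) :
    HasValue x (ρ + σ) (z + w) := by
  obtain ⟨N, D, hD, rfl, rfl⟩ := hρ
  obtain ⟨N', D', hD', rfl, rfl⟩ := hσ
  refine ⟨N * D' + D * N', D * D', by simp [hD, hD'], ?_, ?_⟩
  · rw [div_add_div _ _ (algebraMap_ne_zero_of_aeval_ne_zero hD)
      (algebraMap_ne_zero_of_aeval_ne_zero hD')]
    simp only [map_add, map_mul]
  · rw [div_add_div _ _ hD hD']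
    simp only [map_add, map_mul]

theorem HasValue.mul (hρ : HasValue x ρ z) (hσ : HasValue x σ w) :
    HasValue x (ρ * σ) (z * w) := by
  obtain ⟨N, D, hD, rfl, rfl⟩ := hρ
  obtain ⟨N', D', hD', rfl, rfl⟩ := hσ
  refine ⟨N * N', D * D', by simp [hD, hD'], ?_, ?_⟩ <;>
    simp only [div_mul_div_comm, map_mul]

theorem HasValue.inv (hρ : HasValue x ρ z) (hz : z ≠ 0) : HasValue x ρ⁻¹ z⁻¹ := by
  obtain ⟨N, D, -, rfl, rfl⟩ := hρ
  exact ⟨D, N, (div_ne_zero_iff.1 hz).1, inv_div _ _, inv_div _ _⟩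

theorem HasValue.div (hρ : HasValue x ρ z) (hσ : HasValue x σ w) (hw : w ≠ 0) :
    HasValue x (ρ / σ) (z / w) := by
  rw [div_eq_mul_inv, div_eq_mul_inv]
  exact hρ.mul (hσ.inv hw)

theorem HasValue.sub (hρ : HasValue x ρ z) (hσ : HasValue x σ w) :
    HasValue x (ρ - σ) (z - w) := by
  simpa [sub_eq_add_neg] using hρ.add ((hasValue_const (-1)).mul hσ)

theorem HasValue.aeval {a : Fin 2 → Rat2 K} {u : Fin 2 → L} (ha : ∀ i, HasValue x (a i) (u i))
    (P : Poly K) : HasValue x (aeval a P) (aeval u P) := by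
  induction P using MvPolynomial.induction_on with
  | C c => simpa only [aeval_C] using hasValue_const c
  | add P Q hP hQ => simpa only [map_add] using hP.add hQ
  | mul_X P i hP => simpa only [map_mul, aeval_X] using hP.mul (ha i)

theorem numer_div_denom (ρ : Rat2 K) :
    algebraMap (Poly K) (Rat2 K) (numer ρ) / algebraMap (Poly K) (Rat2 K) (denom ρ) = ρ :=
  IsFractionRing.mk'_num_den' (Poly K) ρ

theorem hasValue_of_aeval_denom_ne_zero (h : MvPolynomial.aeval x (denom ρ) ≠ 0) :
    HasValue x ρ (MvPolynomial.aeval x (numer ρ) / MvPolynomial.aeval x (denom ρ)) :=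
  ⟨numer ρ, denom ρ, h, (numer_div_denom ρ).symm, rfl⟩

theorem mul_denom_eq_numer_mul {N D : Poly K} (hD : D ≠ 0)
    (h : ρ = algebraMap (Poly K) (Rat2 K) N / algebraMap (Poly K) (Rat2 K) D) :
    N * denom ρ = numer ρ * D := by
  have hdenom : denom ρ ≠ 0 := nonZeroDivisors.coe_ne_zero (IsFractionRing.den (Poly K) ρ)
  rw [← numer_div_denom ρ, div_eq_div_iff (by simpa using hdenom) (by simpa using hD)] at h
  apply IsFractionRing.injective (Poly K) (Rat2 K)
  rw [map_mul, map_mul, h]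

theorem HasValue.aeval_denom_ne_zero (h : HasValue x ρ z) :
    MvPolynomial.aeval x (denom ρ) ≠ 0 := by
  obtain ⟨N, D, hD, hρ, -⟩ := h
  have hdvd : denom ρ ∣ D :=
    (IsFractionRing.num_den_reduced (Poly K) ρ).symm.dvd_of_dvd_mul_left
      (mul_denom_eq_numer_mul (ne_zero_of_map hD) hρ ▸ dvd_mul_left (denom ρ) N)
  exact ne_zero_of_dvd_ne_zero hD (map_dvd (MvPolynomial.aeval x) hdvd)

theorem HasValue.eq_aeval_div (h : HasValue x ρ z) :
    z = MvPolynomial.aeval x (numer ρ) / MvPolynomial.aeval x (denom ρ) := by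
  have hdenom := h.aeval_denom_ne_zero
  obtain ⟨N, D, hD, hρ, rfl⟩ := h
  rw [div_eq_div_iff hD hdenom, ← map_mul, ← map_mul,
    mul_denom_eq_numer_mul (ne_zero_of_map hD) hρ]

theorem HasValue.comp {a b : Rat2 K} {u v : L} (ha : HasValue x a u) (hb : HasValue x b v)
    (h : HasValue ![u, v] ρ z) : HasValue x (evalAt a b ρ) z := by
  have hab (i : Fin 2) : HasValue x (![a, b] i) (![u, v] i) := by
    fin_cases i
    exacts [ha, hb]
  rw [h.eq_aeval_div]
  exact (HasValue.aeval hab _).div (HasValue.aeval hab _) h.aeval_denom_ne_zero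

theorem HasValue.evalAt_eq {u v : L} (h : HasValue ![u, v] ρ z) : evalAt u v ρ = z :=
  h.eq_aeval_div.symm

theorem HasValue.mobius (hρ : HasValue x ρ z) (T : GL (Fin 2) K)
    (hz : algebraMap K L (T 1 0) * z + algebraMap K L (T 1 1) ≠ 0) :
    HasValue x (mobius T ρ) (fracLinear T z) :=
  (((hasValue_const _).mul hρ).add (hasValue_const _)).div
    (((hasValue_const _).mul hρ).add (hasValue_const _)) hz

variable {Γ : Type*} [LinearOrderedCommGroupWithZero Γ] {ν : Valuation L Γ} [ν.IsTrivialOn K]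
  {u v : L}

theorem hasValue_compMobius (hu : 1 < ν u) (hv : 1 < ν v) (S₁ S₂ : GL (Fin 2) K)
    (h : HasValue ![fracLinear S₁ u, fracLinear S₂ v] ρ z) :
    HasValue ![u, v] (compMobius ρ S₁ S₂) z :=
  ((hasValue_X 0).mobius S₁ (fracLinear_denom_ne_zero S₁ hu)).comp
    ((hasValue_X 1).mobius S₂ (fracLinear_denom_ne_zero S₂ hv)) h

theorem aeval_numer_compMobius_eq_zero_iff (hu : 1 < ν u) (hv : 1 < ν v) (S₁ S₂ : GL (Fin 2) K)
    (p : Poly K) :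
    aeval ![u, v] (numer (compMobius (algebraMap (Poly K) (Rat2 K) p) S₁ S₂)) = 0 ↔
      aeval ![fracLinear S₁ u, fracLinear S₂ v] p = 0 := by
  have h := hasValue_compMobius hu hv S₁ S₂ (hasValue_algebraMap p)
  rw [h.eq_aeval_div, div_eq_zero_iff, or_iff_left h.aeval_denom_ne_zero]

end Value

/-! ### Generic points of a plane curve -/

section GenericPoint

variable {L : Type*} [Field L]

theorem dvd_of_eval₂_eq_zero {R : Type*} [CommRing R] [IsDomain R] [UniqueFactorizationMonoid R]
    {P H : Polynomial R} (hP : Irreducible P) (hdeg : P.natDegree ≠ 0) {φ : R →+* L}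
    (hφ : Function.Injective φ) {x : L} (hPx : P.eval₂ φ x = 0) (hHx : H.eval₂ φ x = 0) :
    P ∣ H := by
  let _ : NormalizedGCDMonoid R := Classical.choice inferInstance
  let ψ : FractionRing R →+* L := IsFractionRing.lift hφ
  have hψ : ψ.comp (algebraMap R (FractionRing R)) = φ :=
    RingHom.ext (IsFractionRing.lift_algebraMap hφ)
  have hprim : P.IsPrimitive := hP.isPrimitive hdeg
  have hroot {Q : Polynomial R} (hQ : Q.eval₂ φ x = 0) :
      (Q.map (algebraMap R (FractionRing R))).eval₂ ψ x = 0 := by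
    rwa [Polynomial.eval₂_map, hψ]
  refine hprim.dvd_of_fraction_map_dvd_fraction_map (K := FractionRing R) ?_
  by_contra hndvd
  obtain ⟨A, B, hAB⟩ :=
    (hprim.irreducible_iff_irreducible_map_fraction_map.1 hP).coprime_iff_not_dvd.2 hndvd
  simpa [Polynomial.eval₂_add, Polynomial.eval₂_mul, hroot hPx, hroot hHx] using
    congr_arg (Polynomial.eval₂ ψ x) hAB

variable {K : Type*} [Field K] [Algebra K L]

theorem dvd_of_aeval_eq_zero_of_algebraicIndependent {σ : Type*} {p h : MvPolynomial σ K}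
    (hp : Irreducible p) {i : σ} (hpi : p.degreeOf i ≠ 0) {x : σ → L}
    (hx : AlgebraicIndependent K fun j : {j // j ≠ i} => x j)
    (hpx : MvPolynomial.aeval x p = 0) (hhx : MvPolynomial.aeval x h = 0) : p ∣ h := by
  classical
  let e : MvPolynomial σ K ≃ₐ[K] Polynomial (MvPolynomial {j // j ≠ i} K) :=
    (MvPolynomial.renameEquiv K (Equiv.optionSubtypeNe i).symm).trans
      (MvPolynomial.optionEquivLeft K {j // j ≠ i})
  let φ : MvPolynomial {j // j ≠ i} K →ₐ[K] L := MvPolynomial.aeval fun j => x j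
  have he : MvPolynomial.aeval x =
      (Polynomial.eval₂AlgHom φ (x i) fun _ => .all _ _).comp e.toAlgHom := by
    refine MvPolynomial.algHom_ext fun j => ?_
    obtain rfl | hj := eq_or_ne j i
    · simp [e]
    · simp [e, φ, Equiv.optionSubtypeNe_symm_of_ne hj]
  rw [← map_dvd_iff e]
  exact dvd_of_eval₂_eq_zero ((MulEquiv.irreducible_iff e).2 hp)
    (by rwa [MvPolynomial.degreeOf_eq_natDegree] at hpi) hx
    ((DFunLike.congr_fun he p).symm.trans hpx) ((DFunLike.congr_fun he h).symm.trans hhx)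

theorem dvd_of_aeval_eq_zero_of_transcendental {p h : Poly K} (hp : Irreducible p) {i j : Fin 2}
    (hij : i ≠ j) (hpi : p.degreeOf i ≠ 0) {x : Fin 2 → L} (hx : Transcendental K (x j))
    (hpx : MvPolynomial.aeval x p = 0) (hhx : MvPolynomial.aeval x h = 0) : p ∣ h := by
  let _ : Unique {k : Fin 2 // k ≠ i} := ⟨⟨⟨j, hij.symm⟩⟩, fun k => Subtype.ext (by grind)⟩
  exact dvd_of_aeval_eq_zero_of_algebraicIndependent hp hpi
    (algebraicIndependent_unique_type_iff.2 hx) hpx hhx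

end GenericPoint

/-! ### The bi-homogenization -/

section BiHomogenization

open MvPolynomial

variable {K : Type*} [Field K] {p : Poly K}

theorem aeval_biHomogenization {R : Type*} [CommRing R] [Algebra K R] (p : Poly K)
    (Z : Fin 2 × Fin 2 → R) :
    aeval Z (biHomogenization p) = ∑ m ∈ p.support, algebraMap K R (p.coeff m) *
      ∏ k, Z (k, 0) ^ (p.degreeOf k - m k) * Z (k, 1) ^ m k := by
  simp [biHomogenization, mul_assoc]

theorem mem_curve_iff {s : OnePoint K × OnePoint K} :
    s ∈ curve p ↔
      aeval (fun i : Fin 2 × Fin 2 => homCoords (![s.1, s.2] i.1) i.2)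
        (biHomogenization p) = 0 := by
  have hcoords : (fun i : Fin 2 × Fin 2 => homCoords (![s.1, s.2] i.1) i.2) =
      fun i => if i.1 = 0 then homCoords s.1 i.2 else homCoords s.2 i.2 := by
    ext ⟨k, l⟩
    fin_cases k <;> rfl
  rw [hcoords, aeval_eq_eval]
  rfl

variable {L : Type*} [Field L] [Algebra K L] {Z : Fin 2 × Fin 2 → L}

theorem aeval_biHomogenization_eq_mul (p : Poly K) (hZ : ∀ k, Z (k, 0) ≠ 0) :
    aeval Z (biHomogenization p) =
      (∏ k, Z (k, 0) ^ p.degreeOf k) * aeval (fun k => Z (k, 1) / Z (k, 0)) p := by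
  rw [aeval_biHomogenization, aeval_def, eval₂_eq', Finset.mul_sum]
  refine Finset.sum_congr rfl fun m hm => ?_
  rw [mul_left_comm, ← Finset.prod_mul_distrib]
  congr 1
  refine Finset.prod_congr rfl fun k _ => ?_
  rw [pow_sub₀ _ (hZ k) (monomial_le_degreeOf k hm), div_pow]
  ring

/-- The coefficient of the highest power of `X i` in `p`, as a polynomial in the variable `X j`. -/
noncomputable def topCoeff (i j : Fin 2) (p : Poly K) : Polynomial K :=
  ∑ m ∈ p.support with m i = p.degreeOf i, Polynomial.monomial (m j) (p.coeff m)

variable {i j : Fin 2}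

theorem topCoeff_ne_zero (hij : i ≠ j) (hp : p ≠ 0) : topCoeff i j p ≠ 0 := by
  obtain ⟨m, hm, hmi⟩ := Finset.exists_mem_eq_sup p.support (support_nonempty.2 hp) (fun m => m i)
  rw [← degreeOf_eq_sup] at hmi
  intro h
  have hcoeff := congr_arg (Polynomial.coeff · (m j)) h
  simp only [topCoeff, Polynomial.finsetSum_coeff, Polynomial.coeff_monomial,
    Polynomial.coeff_zero] at hcoeff
  rw [Finset.sum_eq_single_of_mem m (Finset.mem_filter.2 ⟨hm, hmi.symm⟩), if_pos rfl] at hcoeff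
  · exact mem_support_iff.1 hm hcoeff
  · intro m' hm' hne
    refine if_neg fun hj => hne (Finsupp.ext fun k => ?_)
    obtain rfl | rfl : k = i ∨ k = j := by omega
    exacts [(Finset.mem_filter.1 hm').2.trans hmi, hj]

theorem aeval_biHomogenization_of_eq_zero (hij : i ≠ j) (hi : Z (i, 0) = 0) (hj : Z (j, 0) ≠ 0) :
    aeval Z (biHomogenization p) = Z (i, 1) ^ p.degreeOf i * Z (j, 0) ^ p.degreeOf j *
      Polynomial.aeval (Z (j, 1) / Z (j, 0)) (topCoeff i j p) := by
  rw [aeval_biHomogenization, topCoeff, map_sum, Finset.mul_sum, Finset.sum_filter]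
  refine Finset.sum_congr rfl fun m hm => ?_
  rw [Fintype.prod_eq_mul i j hij (by omega), hi]
  split_ifs with hmi
  · rw [Polynomial.aeval_monomial, hmi, Nat.sub_self,
      pow_sub₀ _ hj (monomial_le_degreeOf j hm), div_pow]
    ring
  · rw [zero_pow (Nat.sub_ne_zero_of_lt ((monomial_le_degreeOf i hm).lt_of_ne hmi))]
    ring

theorem not_dvd_X_sub_C (hij : i ≠ j) (hpj : p.degreeOf j ≠ 0) (c : K) : ¬ p ∣ X i - C c := by
  rintro ⟨q, hq⟩
  have hne : p * q ≠ 0 := fun h => by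
    simpa using congr_arg (eval fun _ => c + 1) (hq.trans h)
  have hdeg : degreeOf j (X i - C c : Poly K) = 0 := by
    refine Nat.le_zero.1 ((degreeOf_sub_le j _ _).trans ?_)
    rw [degreeOf_X_of_ne hij.symm, degreeOf_C, max_self]
  rw [hq, degreeOf_mul_eq (left_ne_zero_of_mul hne) (right_ne_zero_of_mul hne)] at hdeg
  exact hpj (Nat.eq_zero_of_add_eq_zero_right hdeg)

theorem aeval_biHomogenization_ne_zero (hp : Irreducible p) (hdeg : ∀ k, p.degreeOf k ≠ 0)
    (hij : i ≠ j) {α : Fin 2 → K} (hα : α ≠ 0) (hi : ∀ l, Z (i, l) = algebraMap K L (α l))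
    (hj : Z (j, 0) ≠ 0) (htr : Transcendental K (Z (j, 1) / Z (j, 0))) :
    aeval Z (biHomogenization p) ≠ 0 := by
  by_cases hα0 : α 0 = 0
  · have hα1 : α 1 ≠ 0 := fun hα1 => hα (funext (Fin.forall_fin_two.2 ⟨hα0, hα1⟩))
    have hi1 : Z (i, 1) ≠ 0 := by simpa [hi] using hα1
    rw [aeval_biHomogenization_of_eq_zero hij (by rw [hi, hα0, map_zero]) hj]
    exact mul_ne_zero (mul_ne_zero (pow_ne_zero _ hi1) (pow_ne_zero _ hj)) fun h =>
      topCoeff_ne_zero hij hp.ne_zero (transcendental_iff.1 htr _ h)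
  · have hZ (k : Fin 2) : Z (k, 0) ≠ 0 := by
      obtain rfl | rfl : k = i ∨ k = j := by omega
      exacts [by simpa [hi] using hα0, hj]
    rw [aeval_biHomogenization_eq_mul p hZ]
    refine mul_ne_zero (Finset.prod_ne_zero_iff.2 fun k _ => pow_ne_zero _ (hZ k)) fun h => ?_
    refine not_dvd_X_sub_C hij (hdeg j) (α 1 / α 0)
      (dvd_of_aeval_eq_zero_of_transcendental hp hij (hdeg i) htr h ?_)
    simp [hi]

end BiHomogenization

/-! ### Puiseux series through the points of a curve -/

section Place

open MvPolynomial

variable {K : Type*} [Field K]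

/-- Homogeneous coordinates of `T (1 / τ)`, a point near `T ∞` if the local parameter `τ` is
small. -/
def nearCoords {R : Type*} [CommRing R] [Algebra K R] (T : GL (Fin 2) K) (τ : R) : Fin 2 → R :=
  ![algebraMap K R (T 1 0) + algebraMap K R (T 1 1) * τ,
    algebraMap K R (T 0 0) + algebraMap K R (T 0 1) * τ]

/-- The equation of the curve associated with `p` in the local parameters of the two projective
lines at the point `(T 0 ∞, T 1 ∞)`, which correspond to the origin. -/
noncomputable def localEquation (p : Poly K) (T : Fin 2 → GL (Fin 2) K) : Poly K :=
  aeval (fun i : Fin 2 × Fin 2 => nearCoords (T i.1) (X i.1 : Poly K) i.2) (biHomogenization p)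

theorem nearCoords_zero {R : Type*} [CommRing R] [Algebra K R] (T : GL (Fin 2) K) (l : Fin 2) :
    nearCoords T (0 : R) l = algebraMap K R (nearCoords T (0 : K) l) := by
  fin_cases l <;> simp [nearCoords]

theorem nearCoords_zero_ne_zero (T : GL (Fin 2) K) : nearCoords T (0 : K) ≠ 0 := by
  intro h
  have h1 : T 1 0 = 0 := by simpa [nearCoords] using congr_fun h 0
  have h0 : T 0 0 = 0 := by simpa [nearCoords] using congr_fun h 1
  exact T.det_ne_zero (by rw [Matrix.det_fin_two, h0, h1, zero_mul, mul_zero, sub_zero])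

theorem exists_smul_infty_eq [DecidableEq K] (a : OnePoint K) :
    ∃ T : GL (Fin 2) K, T • OnePoint.infty = a ∧ nearCoords T (0 : K) = homCoords a := by
  induction a using OnePoint.rec with
  | infty =>
    refine ⟨1, one_smul _ _, ?_⟩
    ext l
    fin_cases l <;> simp [nearCoords, homCoords]
  | coe c =>
    refine ⟨.mkOfDetNeZero !![c, 1; 1, 0] (by simp), ?_, ?_⟩
    · simp [OnePoint.smul_infty_eq_ite]
    · ext l
      fin_cases l <;> simp [nearCoords, homCoords]

theorem aeval_localEquation {R : Type*} [CommRing R] [Algebra K R] (p : Poly K)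
    (T : Fin 2 → GL (Fin 2) K) (τ : Fin 2 → R) :
    aeval τ (localEquation p T) =
      aeval (fun i : Fin 2 × Fin 2 => nearCoords (T i.1) (τ i.1) i.2) (biHomogenization p) := by
  rw [localEquation, comp_aeval_apply]
  congr 2
  ext ⟨k, l⟩
  fin_cases l <;> simp [nearCoords]

theorem eval₂_aeval_C_X {R S : Type*} [CommRing R] [Algebra K R] [CommRing S] [Algebra K S]
    {f : R →+* S} (hf : ∀ c : K, f (algebraMap K R c) = algebraMap K S c) (a : R) (b : S)
    (P : Poly K) :
    (aeval ![Polynomial.C a, Polynomial.X] P).eval₂ f b = aeval ![f a, b] P := by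
  induction P using MvPolynomial.induction_on with
  | C c => simp [hf, Polynomial.algebraMap_apply]
  | add P Q hP hQ => rw [map_add, Polynomial.eval₂_add, hP, hQ, map_add]
  | mul_X P i hP =>
    rw [map_mul, Polynomial.eval₂_mul, hP, map_mul, aeval_X, aeval_X]
    fin_cases i <;> simp

section Valuation

variable {L Γ : Type*} [Field L] [Algebra K L] [LinearOrderedCommGroupWithZero Γ]
  {ν : Valuation L Γ} [ν.IsTrivialOn K]

theorem nearCoords_inv_zero (T : GL (Fin 2) K) {z : L} (hz : z ≠ 0) :
    nearCoords T z⁻¹ 0 = z⁻¹ * (algebraMap K L (T 1 0) * z + algebraMap K L (T 1 1)) := by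
  simp only [nearCoords, Matrix.cons_val_zero]
  field_simp

theorem nearCoords_inv_one (T : GL (Fin 2) K) {z : L} (hz : z ≠ 0) :
    nearCoords T z⁻¹ 1 = z⁻¹ * (algebraMap K L (T 0 0) * z + algebraMap K L (T 0 1)) := by
  simp only [nearCoords, Matrix.cons_val_one, Matrix.cons_val_zero]
  field_simp

theorem nearCoords_inv_zero_ne_zero (T : GL (Fin 2) K) {z : L} (hz : 1 < ν z) :
    nearCoords T z⁻¹ 0 ≠ 0 := by
  have hz0 : z ≠ 0 := ν.pos_iff.1 (zero_lt_one.trans hz)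
  rw [nearCoords_inv_zero T hz0]
  exact mul_ne_zero (inv_ne_zero hz0) (fracLinear_denom_ne_zero T hz)

theorem nearCoords_inv_div (T : GL (Fin 2) K) {z : L} (hz : z ≠ 0) :
    nearCoords T z⁻¹ 1 / nearCoords T z⁻¹ 0 = fracLinear T z := by
  rw [nearCoords_inv_zero T hz, nearCoords_inv_one T hz, mul_div_mul_left _ _ (inv_ne_zero hz)]
  rfl

theorem aeval_inv_localEquation_eq_zero_iff (p : Poly K) (T : Fin 2 → GL (Fin 2) K)
    {z : Fin 2 → L} (hz : ∀ k, 1 < ν (z k)) :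
    aeval (fun k => (z k)⁻¹) (localEquation p T) = 0 ↔
      aeval (fun k => fracLinear (T k) (z k)) p = 0 := by
  have hcoord (k : Fin 2) : nearCoords (T k) (z k)⁻¹ 0 ≠ 0 :=
    nearCoords_inv_zero_ne_zero (T k) (hz k)
  have hz0 (k : Fin 2) : z k ≠ 0 := ν.pos_iff.1 (zero_lt_one.trans (hz k))
  rw [aeval_localEquation, aeval_biHomogenization_eq_mul p hcoord, mul_eq_zero,
    or_iff_right (Finset.prod_ne_zero_iff.2 fun k _ => pow_ne_zero _ (hcoord k))]
  simp only [nearCoords_inv_div (T _) (hz0 _)]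

theorem aeval_localEquation_ne_zero {p : Poly K} (hp : Irreducible p)
    (hdeg : ∀ k, p.degreeOf k ≠ 0) (T : Fin 2 → GL (Fin 2) K) {i j : Fin 2} (hij : i ≠ j)
    {τ : Fin 2 → L} (hi : τ i = 0) {z : L} (hz : 1 < ν z) (hj : τ j = z⁻¹) :
    aeval τ (localEquation p T) ≠ 0 := by
  rw [aeval_localEquation]
  refine aeval_biHomogenization_ne_zero hp hdeg hij (nearCoords_zero_ne_zero (T i))
    (fun l => by rw [hi, nearCoords_zero]) ?_ ?_
  · rw [hj]
    exact nearCoords_inv_zero_ne_zero (T j) hz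
  · rw [hj, nearCoords_inv_div (T j) (ν.pos_iff.1 (zero_lt_one.trans hz))]
    exact transcendental_fracLinear (T j) hz

end Valuation

variable [IsAlgClosed K] [CharZero K]

theorem exists_puiseux_branch {P : Poly K} (h00 : aeval (![0, 0] : Fin 2 → K) P = 0)
    (h0y : aeval ![0, (xSeries K)⁻¹] P ≠ 0) (hx0 : aeval ![(xSeries K)⁻¹, 0] P ≠ 0) :
    ∃ φ : HahnSeries ℚ K, IsPuiseux φ ∧ 1 < hahnVal K φ ∧ aeval ![(xSeries K)⁻¹, φ⁻¹] P = 0 := by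
  let q : Polynomial (PowerSeries K) := aeval ![Polynomial.C PowerSeries.X, Polynomial.X] P
  have hq : q.map (PowerSeries.constantCoeff (R := K)) ≠ 0 := fun h => h0y <| by
    have heval := eval₂_aeval_C_X (P := P) (b := (xSeries K)⁻¹) (a := PowerSeries.X)
      (f := (algebraMap K (HahnSeries ℚ K)).comp PowerSeries.constantCoeff) (fun c => by simp)
    rw [← Polynomial.eval₂_map, h, Polynomial.eval₂_zero, RingHom.comp_apply,
      PowerSeries.constantCoeff_X, map_zero] at heval
    exact heval.symm
  have hq0 : PowerSeries.constantCoeff (q.coeff 0) = 0 := by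
    have heval := eval₂_aeval_C_X (P := P) (b := 0) (a := PowerSeries.X)
      (f := PowerSeries.constantCoeff (R := K)) (fun c => PowerSeries.constantCoeff_C c)
    rw [Polynomial.eval₂_at_zero, PowerSeries.constantCoeff_X] at heval
    exact heval.trans h00
  obtain ⟨n, hn, z, hz0, hz⟩ := exists_puiseux_root_constantCoeff_eq_zero hq hq0
  have hroot : aeval ![(xSeries K)⁻¹, puiseuxHom n hn z] P = 0 := by
    have heval := eval₂_aeval_C_X (P := P) (b := puiseuxHom n hn z) (a := PowerSeries.X)
      (f := (puiseuxHom n hn).comp (PowerSeries.expand (R := K) n hn).toRingHom) (fun c => by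
        simp [puiseuxHom_C, PowerSeries.expand_C])
    rw [← Polynomial.hom_eval₂, hz, map_zero] at heval
    simpa [puiseuxHom_X_pow, PowerSeries.expand_X] using heval.symm
  have hzne : puiseuxHom n hn z ≠ 0 := fun h => hx0 (by rwa [h] at hroot)
  refine ⟨(puiseuxHom n hn z)⁻¹, isPuiseux_inv_puiseuxHom n hn z, ?_, by rwa [inv_inv]⟩
  rw [map_inv₀, one_lt_inv₀ ((hahnVal K).pos_iff.2 hzne)]
  exact hahnVal_puiseuxHom_lt_one n hn hz0

theorem exists_puiseux_place [DecidableEq K] {p : Poly K} (hp : Irreducible p)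
    (hdeg : ∀ k, p.degreeOf k ≠ 0) {s : OnePoint K × OnePoint K} (hs : s ∈ curve p) :
    ∃ T₁ T₂ : GL (Fin 2) K, T₁ • OnePoint.infty = s.1 ∧ T₂ • OnePoint.infty = s.2 ∧
      ∃ φ : HahnSeries ℚ K, IsPuiseux φ ∧ 1 < hahnVal K φ ∧
        aeval ![fracLinear T₁ (xSeries K), fracLinear T₂ φ] p = 0 := by
  obtain ⟨T₁, hT₁, hs₁⟩ := exists_smul_infty_eq s.1
  obtain ⟨T₂, hT₂, hs₂⟩ := exists_smul_infty_eq s.2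
  refine ⟨T₁, T₂, hT₁, hT₂, ?_⟩
  have hx := one_lt_hahnVal_xSeries (K := K)
  have h00 : aeval (![0, 0] : Fin 2 → K) (localEquation p ![T₁, T₂]) = 0 := by
    rw [aeval_localEquation]
    refine Eq.trans ?_ (mem_curve_iff.1 hs)
    congr 2
    ext ⟨k, l⟩
    fin_cases k <;> simp [hs₁, hs₂]
  obtain ⟨φ, hφp, hφ, h0⟩ := exists_puiseux_branch h00
    (aeval_localEquation_ne_zero hp hdeg _ zero_ne_one rfl hx rfl)
    (aeval_localEquation_ne_zero hp hdeg _ one_ne_zero rfl hx rfl)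
  refine ⟨φ, hφp, hφ, ?_⟩
  have hiff := aeval_inv_localEquation_eq_zero_iff (ν := hahnVal K) p ![T₁, T₂]
    (z := ![xSeries K, φ]) (Fin.forall_fin_two.2 ⟨hx, hφ⟩)
  rw [← FinVec.etaExpand_eq (fun k => _⁻¹), ← FinVec.etaExpand_eq (fun k => fracLinear _ _)]
    at hiff
  exact hiff.1 h0

end Place

/-! ### Poles of separated functions -/

section Separated

open MvPolynomial

variable {K L Γ : Type*} [Field K] [Field L] [Algebra K L] [LinearOrderedCommGroupWithZero Γ]
  {ν : Valuation L Γ}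

/-- `S` is the set of poles of `f ∈ K(x, y)`, as seen by `ν`, on the projective line with the
coordinate `X i`: where this coordinate has a non-constant value centred at `a`, the function `f`
has a value, which is a pole of `ν` if and only if `a ∈ S`. -/
def IsPoleSet (ν : Valuation L Γ) (i : Fin 2) (f : Rat2 K) (S : Set (OnePoint K)) : Prop :=
  ∀ (a : OnePoint K) (x : Fin 2 → L), Transcendental K (x i) → IsCenter ν (x i) a →
    ∃ z, HasValue x f z ∧ (1 < ν z ↔ a ∈ S)

theorem exists_finite_isPoleSet [ν.IsTrivialOn K] {i : Fin 2} {f : Rat2 K}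
    (hf : f ∈ IntermediateField.adjoin K {algebraMap (Poly K) (Rat2 K) (X i)}) :
    ∃ S : Set (OnePoint K), S.Finite ∧ IsPoleSet ν i f S := by
  obtain ⟨A, B, hAB, hB, rfl⟩ := exists_isCoprime_aeval_div_eq_of_mem_adjoin hf
  obtain ⟨S, hS, hpoles⟩ := exists_finite_poles ν hAB hB
  refine ⟨S, hS, fun a x hx ha => ?_⟩
  have hBx : Polynomial.aeval (x i) B ≠ 0 := fun h => hx ⟨B, hB, h⟩
  have hvalue (P : Polynomial K) :
      HasValue x (Polynomial.aeval (algebraMap (Poly K) (Rat2 K) (X i)) P)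
        (Polynomial.aeval (x i) P) := by
    have h := hasValue_algebraMap (x := x) (Polynomial.aeval (X i : Poly K) P)
    rwa [← Polynomial.aeval_algebraMap_apply, ← Polynomial.aeval_algHom_apply, aeval_X] at h
  exact ⟨_, (hvalue A).div (hvalue B) hBx, hpoles a (x i) ha hBx⟩

variable {p : Poly K} {r : Rat2 K} {fg : Kx K × Ky K}

theorem hasValue_of_mem_F (hp : Irreducible p) (hpx : p.degreeOf 0 ≠ 0) (hfg : fg ∈ F r p)
    {x : Fin 2 → L} {z w : L} (hx : Transcendental K (x 1)) (hpx0 : aeval x p = 0)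
    (hz : HasValue x (fg.1 : Rat2 K) z) (hw : HasValue x (fg.2 : Rat2 K) w) :
    HasValue x r (z - w) := by
  obtain ⟨-, ⟨q, hq, rfl⟩, hsub⟩ := hfg
  have hqx : aeval x (denom q) ≠ 0 := fun h =>
    hq (dvd_of_aeval_eq_zero_of_transcendental hp zero_ne_one hpx hx hpx0 h)
  have hvalue :=
    (hz.sub hw).sub ((hasValue_of_aeval_denom_ne_zero hqx).mul (hasValue_algebraMap p))
  rwa [hpx0, mul_zero, sub_zero, hsub, add_sub_cancel_right] at hvalue

variable {S T : Set (OnePoint K)}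

theorem exists_evalAt_compMobius_eq_sub [DecidableEq K] [ν.IsTrivialOn K] (hp : Irreducible p)
    (hpx : p.degreeOf 0 ≠ 0) (hfg : fg ∈ F r p) (hS : IsPoleSet ν 0 (fg.1 : Rat2 K) S)
    (hT : IsPoleSet ν 1 (fg.2 : Rat2 K) T) (S₁ S₂ : GL (Fin 2) K) {u v : L} (hu : 1 < ν u)
    (hv : 1 < ν v) (h0 : aeval ![fracLinear S₁ u, fracLinear S₂ v] p = 0) :
    ∃ z w, evalAt u v (compMobius r S₁ S₂) = z - w ∧
      (1 < ν z ↔ S₁ • (OnePoint.infty : OnePoint K) ∈ S) ∧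
      (1 < ν w ↔ S₂ • (OnePoint.infty : OnePoint K) ∈ T) := by
  obtain ⟨z, hz, hzS⟩ := hS _ ![fracLinear S₁ u, fracLinear S₂ v]
    (transcendental_fracLinear S₁ hu) (isCenter_fracLinear S₁ hu)
  obtain ⟨w, hw, hwT⟩ := hT _ ![fracLinear S₁ u, fracLinear S₂ v]
    (transcendental_fracLinear S₂ hv) (isCenter_fracLinear S₂ hv)
  have hr : HasValue ![fracLinear S₁ u, fracLinear S₂ v] r (z - w) :=
    hasValue_of_mem_F hp hpx hfg (transcendental_fracLinear S₂ hv) h0 hz hw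
  exact ⟨z, w, (hasValue_compMobius hu hv S₁ S₂ hr).evalAt_eq, hzS, hwT⟩

theorem mem_or_mem_of_isPole (hp : Irreducible p) (hpx : p.degreeOf 0 ≠ 0) (hfg : fg ∈ F r p)
    (hS : IsPoleSet (hahnVal K) 0 (fg.1 : Rat2 K) S)
    (hT : IsPoleSet (hahnVal K) 1 (fg.2 : Rat2 K) T) {s : OnePoint K × OnePoint K}
    (hs : IsPole r p s) : s.1 ∈ S ∨ s.2 ∈ T := by
  classical
  obtain ⟨-, T₁, T₂, hT₁, hT₂, φ, -, h0, hφ, hr⟩ := hs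
  rw [zero_lt_deg_iff] at hφ hr
  have hx := one_lt_hahnVal_xSeries (K := K)
  obtain ⟨z, w, hzw, hzS, hwT⟩ := exists_evalAt_compMobius_eq_sub hp hpx hfg hS hT _ _ hx hφ
    ((aeval_numer_compMobius_eq_zero_iff hx hφ _ _ p).1 h0)
  rw [← hT₁, inv_smul_smul] at hzS
  rw [← hT₂, inv_smul_smul] at hwT
  rw [← hzS, ← hwT]
  exact one_lt_or_one_lt_of_one_lt_sub _ (hzw ▸ hr)

theorem mem_iff_mem_of_not_isPole [IsAlgClosed K] [CharZero K] (hp : Irreducible p)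
    (hdeg : ∀ k, p.degreeOf k ≠ 0) (hfg : fg ∈ F r p)
    (hS : IsPoleSet (hahnVal K) 0 (fg.1 : Rat2 K) S)
    (hT : IsPoleSet (hahnVal K) 1 (fg.2 : Rat2 K) T) {s : OnePoint K × OnePoint K}
    (hs : s ∈ curve p) (hpole : ¬ IsPole r p s) : s.1 ∈ S ↔ s.2 ∈ T := by
  classical
  have hx := one_lt_hahnVal_xSeries (K := K)
  obtain ⟨T₁, T₂, hT₁, hT₂, φ, hφp, hφ, h0⟩ := exists_puiseux_place hp hdeg hs
  obtain ⟨z, w, hzw, hzS, hwT⟩ :=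
    exists_evalAt_compMobius_eq_sub hp (hdeg 0) hfg hS hT T₁ T₂ hx hφ h0
  rw [hT₁] at hzS
  rw [hT₂] at hwT
  rw [← hzS, ← hwT]
  refine one_lt_iff_of_sub_le_one _ (not_lt.1 fun hr => hpole ?_)
  refine ⟨hs, T₁⁻¹, T₂⁻¹, inv_smul_eq_iff.2 hT₁.symm, inv_smul_eq_iff.2 hT₂.symm, φ, hφp, ?_,
    (zero_lt_deg_iff φ).2 hφ, ?_⟩
  · rwa [inv_inv, inv_inv, aeval_numer_compMobius_eq_zero_iff hx hφ]
  · rwa [inv_inv, inv_inv, zero_lt_deg_iff, hzw]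

end Separated

/-! ### Paths -/

section Path

variable {K : Type*} [Field K] {p : Poly K} {r : Rat2 K} {s : curve p} {v : ℕ → orbit p s}

theorem IsAdmissiblePath.not_isPole_succ (hv : IsAdmissiblePath r p s v) (i : ℕ) :
    ¬ IsPole r p (v (i + 1)).1.1 := by
  obtain ⟨-, hcyc, h0, hpole⟩ := hv
  exact fun h => hcyc 0 (i + 1) i.succ_pos (Subtype.ext (h0.trans (hpole _ h).symm))

theorem IsAdmissiblePath.not_mem_or_mem (hv : IsAdmissiblePath r p s v) {S T : Set (OnePoint K)}
    (hS : S.Finite) (hT : T.Finite)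
    (hST : ∀ s ∈ curve p, ¬ IsPole r p s → (s.1 ∈ S ↔ s.2 ∈ T)) :
    ¬ ((v 1).1.1.1 ∈ S ∨ (v 1).1.1.2 ∈ T) := by
  intro h1
  have hmem_prod (i : ℕ) (h : (v (i + 1)).1.1.1 ∈ S ∨ (v (i + 1)).1.1.2 ∈ T) :
      (v (i + 1)).1.1 ∈ S ×ˢ T := by
    have hiff := hST _ (v (i + 1)).1.2 (hv.not_isPole_succ i)
    exact h.elim (fun h => ⟨h, hiff.1 h⟩) fun h => ⟨hiff.2 h, h⟩
  have hmem (i : ℕ) : (v (i + 1)).1.1 ∈ S ×ˢ T := by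
    induction i with
    | zero => exact hmem_prod 0 h1
    | succ i ih =>
      exact hmem_prod (i + 1) ((hv.1 (i + 1)).2.imp
        (fun h => Set.mem_of_eq_of_mem h.symm ih.1) fun h => Set.mem_of_eq_of_mem h.symm ih.2)
  have hinj : Function.Injective v := .of_lt_imp_ne hv.2.1
  refine Set.infinite_of_injective_forall_mem ?_ hmem (hS.prod hT)
  exact Subtype.val_injective.comp <| Subtype.val_injective.comp <|
    hinj.comp (add_left_injective 1)

end Path

end SepVar

theorem mainTheorem11 {K : Type*} [Field K] [IsAlgClosed K] [CharZero K]
    (p : SepVar.Poly K) (hp : Irreducible p)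
    (hpx : p.degreeOf 0 ≠ 0) (hpy : p.degreeOf 1 ≠ 0)
    (r : SepVar.Rat2 K)
    (s : SepVar.curve p) (hs : SepVar.IsPole r p s)
    (v w : ℕ → SepVar.orbit p s)
    (hv : SepVar.IsAdmissiblePath r p s v) (hw : SepVar.IsAdmissiblePath r p s w)
    (hv1 : (v 1).1.1.1 = s.1.1) (hw1 : (w 1).1.1.2 = s.1.2) :
    SepVar.F r p = ∅ := by
  rw [Set.eq_empty_iff_forall_notMem]
  intro fg hfg
  have hdeg : ∀ k, p.degreeOf k ≠ 0 := Fin.forall_fin_two.2 ⟨hpx, hpy⟩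
  obtain ⟨S, hS, hSpoles⟩ := SepVar.exists_finite_isPoleSet (ν := SepVar.hahnVal K) fg.1.2
  obtain ⟨T, hT, hTpoles⟩ := SepVar.exists_finite_isPoleSet (ν := SepVar.hahnVal K) fg.2.2
  have hST : ∀ s ∈ SepVar.curve p, ¬ SepVar.IsPole r p s → (s.1 ∈ S ↔ s.2 ∈ T) := fun _ =>
    SepVar.mem_iff_mem_of_not_isPole hp hdeg hfg hSpoles hTpoles
  rcases SepVar.mem_or_mem_of_isPole hp hpx hfg hSpoles hTpoles hs with h | h
  · exact hv.not_mem_or_mem hS hT hST (Or.inl (hv1 ▸ h))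
  · exact hw.not_mem_or_mem hS hT hST (Or.inr (hw1 ▸ h))
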